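/- Let $G$ be an abelian group (for instance $\mathbb Z^{r}\times\mathbb Z/c_1\mathbb Z\times\cdots\times\mathbb Z/c_h\mathbb Z$), let $a_1,\dots,a_n\in G$ be nonzero, and let $S=\langle a_1,\dots,a_n\rangle=\{\sum_i\alpha_i a_i:\alpha\in\mathbb N^n\}$ satisfy $S\cap(-S)=\{0\}$. Let $\Bbbk$ be a field. The $S$-degree of a monomial $X^\alpha$ in $\Bbbk[X_1,\dots,X_n]$ is $\sum_i\alpha_i a_i$. The ideal of $S$ is $$I_S=\big\langle X^\alpha-X^\beta:\ \textstyle\sum_i\alpha_ia_i=\sum_i\beta_ia_i\big\rangle\subset\Bbbk[X_1,\dots,X_n].$$ For $B\subseteq\{a_1,\dots,a_n\}$ let $\Bbbk[B]$ be the polynomial subring in the indeterminates $X_i$ with $a_i\in B$, and let $I_{\langle B\rangle}\subset\Bbbk[B]$ be the ideal of the semigroup $\langle B\rangle$, defined in the same way. $S$ is called decomposable if there are $t\ge 2$ subsets $A_1,\dots,A_t$ of $\{a_1,\dots,a_n\}$ such that the $S_i=\langle A_i\rangle$ are proper subsemigroups of $S$, $S=S_1\oplus\cdots\oplus S_t$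 (every element of $S$ is uniquely a sum $s_1+\dots+s_t$ with $s_i\in S_i$), $I_S=I_{S_1}+\cdots+I_{S_t}$ (the $I_{S_i}$ being extended to $\Bbbk[X_1,\dots,X_n]$), and $I_{S_i}\neq 0$ for every $i$. For $m\in S$ let $$\Delta_m=\Big\{F\subseteq\{1,\dots,n\}:\ m-\sum_{i\in F}a_i\in S\Big\},\qquad \nabla_m=\big\{F\subseteq\{\text{monomials of }S\text{-degree }m\}:\ \gcd(F)\ne1\big\}.$$ These are simplicial complexes; such a complex is called not connected if it has at least two connected components (so a complex without vertices is not among them). The following are equivalent. 1. $S$ is decomposable. 2. There are disjoint proper subsets $C_1,C_2$ of $\{a_1,\dots,a_n\}$ with $\{a_1,\dots,a_n\}=C_1\sqcup C_2$ such that: for every $m\in S$ with $\nabla_m$ not connected, either all vertices of $\nabla_m$ belong to $\Bbbk[C_1]$ or all of them belong to $\Bbbk[C_2]$; and there are $m_1,m_2\in S$ with $\nabla_{m_1}$ and $\nabla_{m_2}$ not connected such that the vertices of $\nabla_{m_1}$ belong to $\Bbbk[C_1]$ and the vertices of $\nabla_{m_2}$ belong to $\Bbbk[C_2]$. 3. There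 are disjoint proper subsets $C_1,C_2$ of $\{1,\dots,n\}$ with $\{1,\dots,n\}=C_1\sqcup C_2$ such that: for every $m\in S$ with $\Delta_m$ not connected, either all vertices of $\Delta_m$ belong to $C_1$ or all of them belong to $C_2$; and there are $m_1,m_2\in S$ with $\Delta_{m_1}$ and $\Delta_{m_2}$ not connected such that the vertices of $\Delta_{m_1}$ belong to $C_1$ and the vertices of $\Delta_{m_2}$ belong to $C_2$. -/

import Mathlib

/-!
Semigroups `S = ⟨a₁, …, aₙ⟩` (with zero) in an abelian group are given by the family
`a : Fin n → G` of their generators, so that `S = AddSubmonoid.closure (Set.range a)`.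
Monomials `X ^ α` are written through their exponents `α : σ →₀ ℕ`.
-/

/-- The `S`-degree `∑ αᵢ aᵢ` of the monomial `X ^ α`. -/
noncomputable def sDegree {σ G : Type*} [AddCommGroup G] (a : σ → G) (α : σ →₀ ℕ) : G :=
  α.sum fun i c => c • a i

/-- The ideal `I_S` of the semigroup generated by the family `a`: it is generated by all binomials
`X ^ α - X ^ β` whose two monomials have the same `S`-degree. -/
noncomputable def semigroupIdeal (k : Type*) {σ G : Type*} [Field k] [AddCommGroup G]
    (a : σ → G) : Ideal (MvPolynomial σ k) :=
  Ideal.span {p | ∃ α β : σ →₀ ℕ, sDegree a α = sDegree a β ∧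
    p = MvPolynomial.monomial α (1 : k) - MvPolynomial.monomial β (1 : k)}

/-- The indeterminates of `k[B]`, for a set `B` of generators, are the `Xᵢ` with `aᵢ ∈ B`.
This is the ideal `I_⟨B⟩` of the semigroup `⟨B⟩`, inside `k[B]`. -/
noncomputable def subsemigroupIdeal (k : Type*) {σ G : Type*} [Field k] [AddCommGroup G]
    (a : σ → G) (B : Set G) : Ideal (MvPolynomial {i : σ // a i ∈ B} k) :=
  semigroupIdeal k fun i : {i : σ // a i ∈ B} => a i

/-- `I_⟨B⟩` as an ideal of the whole polynomial ring: the extension along `k[B] ⊆ k[X₁, …, Xₙ]`. -/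
noncomputable def extendedSubsemigroupIdeal (k : Type*) {σ G : Type*} [Field k] [AddCommGroup G]
    (a : σ → G) (B : Set G) : Ideal (MvPolynomial σ k) :=
  (subsemigroupIdeal k a B).map
    (MvPolynomial.rename (R := k) (Subtype.val : {i : σ // a i ∈ B} → σ))

/-- `S = ⟨a₁, …, aₙ⟩` is decomposable: there are `t ≥ 2` sets `A₁, …, A_t` of generators such
that the `Sᵢ = ⟨Aᵢ⟩` are proper subsemigroups, `S` is their direct sum (each element of `S` is in
exactly one way a sum of elements of the `Sᵢ`), `I_S = I_{S₁} + ⋯ + I_{S_t}`, and each summand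
contributes to this decomposition of the ideal, that is, `I_{Sᵢ} ≠ 0`. -/
def IsDecomposable (k : Type*) {σ G : Type*} [Field k] [AddCommGroup G] (a : σ → G) : Prop :=
  ∃ (t : ℕ) (A : Fin t → Set G), 2 ≤ t ∧
    (∀ i, A i ⊆ Set.range a) ∧
    (∀ i, AddSubmonoid.closure (A i) ≠ AddSubmonoid.closure (Set.range a)) ∧
    (∀ x ∈ AddSubmonoid.closure (Set.range a),
      ∃! s : Fin t → G, (∀ i, s i ∈ AddSubmonoid.closure (A i)) ∧ ∑ i, s i = x) ∧
    semigroupIdeal k a = ⨆ i, extendedSubsemigroupIdeal k a (A i) ∧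
    (∀ i, subsemigroupIdeal k a (A i) ≠ ⊥)

/-- The complex `∇_m`: its faces are the finite nonempty sets of monomials of `S`-degree `m` whose
greatest common divisor is not `1`. In terms of exponents the greatest common divisor is the
componentwise minimum, and the monomial `1` has exponent `0`. (The empty face is left out, as
always in `PreAbstractSimplicialComplex`.) -/
noncomputable def nablaComplex {σ G : Type*} [AddCommGroup G] (a : σ → G) (m : G) :
    PreAbstractSimplicialComplex (σ →₀ ℕ) where
  faces := {F | (∀ α ∈ F, sDegree a α = m) ∧ ∃ h : F.Nonempty, F.inf' h id ≠ 0}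
  isRelLowerSet_faces := by
    rintro F ⟨hF, hne, hgcd⟩
    refine ⟨hne, fun F' hsub hne' => ⟨fun α hα => hF α (hsub hα), hne', fun h0 => hgcd ?_⟩⟩
    exact le_antisymm (h0 ▸ Finset.inf'_mono id hsub hne') zero_le

/-- The complex `Δ_m` on the index set: its faces are the nonempty sets `F` of indices with
`m - ∑_{i ∈ F} aᵢ ∈ S`. -/
def deltaComplex {σ G : Type*} [AddCommGroup G] (a : σ → G) (m : G) :
    PreAbstractSimplicialComplex σ where
  faces := {F | F.Nonempty ∧ m - ∑ i ∈ F, a i ∈ AddSubmonoid.closure (Set.range a)}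
  isRelLowerSet_faces := by
    classical
    rintro F ⟨hne, hF⟩
    refine ⟨hne, fun F' hsub hne' => ⟨hne', ?_⟩⟩
    have h : m - ∑ i ∈ F', a i = (m - ∑ i ∈ F, a i) + ∑ i ∈ F \ F', a i := by
      rw [← Finset.sum_sdiff hsub]
      abel
    rw [h]
    exact add_mem hF (sum_mem fun i _ => AddSubmonoid.subset_closure ⟨i, rfl⟩)

/-- The vertices of a simplicial complex. -/
def complexVertices {V : Type*} (K : PreAbstractSimplicialComplex V) : Set V :=
  {v | {v} ∈ K.faces}

/-- A simplicial complex is connected if any two of its vertices are joined by a path in which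
consecutive vertices lie in a common face. It is not connected exactly when it has at least two
connected components; a complex without vertices is not counted among these. -/
def IsConnectedComplex {V : Type*} (K : PreAbstractSimplicialComplex V) : Prop :=
  ∀ v ∈ complexVertices K, ∀ w ∈ complexVertices K,
    Relation.ReflTransGen (fun x y => ∃ F ∈ K.faces, x ∈ F ∧ y ∈ F) v w

/-- All vertices of `∇_m` belong to `k[C]`, the subring generated over `k` by the `Xᵢ` with
`aᵢ ∈ C`. -/
def NablaVerticesIn (k : Type*) {σ G : Type*} [Field k] [AddCommGroup G] (a : σ → G) (m : G)
    (C : Set G) : Prop :=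
  ∀ α ∈ complexVertices (nablaComplex a m),
    MvPolynomial.monomial α (1 : k) ∈ MvPolynomial.supported k {i | a i ∈ C}

/-! ### Monomials, degrees and induction on the degree. -/

section SemigroupDegree

variable {σ G : Type*} [AddCommGroup G]

/-! All three conditions are compared with one statement about an index set `P`: `SplitsAlong a P`,
together with a nontrivial relation inside `P` and one inside `Pᶜ`.

Ideals (`isDecomposable_iff_exists_splitsAlong`): a pure binomial lies in a semigroup ideal exactly
when its two monomials have equal degree. Applied to the family `P.indicator a`, which kills the
generators outside `P`, this turns a decomposition of `I_S` into splitting along `P`. Conversely,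
splitting lets every binomial of `I_S` be written with one binomial in the variables of `P` and one
in those of `Pᶜ`.

Complexes (`splitsAlong_iff_separatesDisconnected`): two monomials joined by an edge of `∇_m` share
a variable, so if `∇_m` is connected, every relation of degree `m` follows from relations of smaller
degree. Hence the disconnected degrees decide, by induction, both whether the relations split and
whether `P` carries one. If degrees split, exchanging `P`-parts connects every `∇_m` whose monomials
are all mixed.

Finally `∇_m` and `Δ_m` are connected simultaneously (`isConnectedComplex_nabla_iff_delta`). -/

theorem sDegree_zero (a : σ → G) : sDegree a 0 = 0 := Finsupp.sum_zero_index

theorem sDegree_add (a : σ → G) (α β : σ →₀ ℕ) :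
    sDegree a (α + β) = sDegree a α + sDegree a β :=
  Finsupp.sum_add_index' (fun _ => zero_smul _ _) (fun _ _ _ => add_smul _ _ _)

theorem sDegree_single (a : σ → G) (i : σ) (c : ℕ) :
    sDegree a (Finsupp.single i c) = c • a i :=
  Finsupp.sum_single_index (zero_smul _ _)

theorem sDegree_single_one (a : σ → G) (i : σ) : sDegree a (Finsupp.single i 1) = a i := by
  rw [sDegree_single, one_smul]

theorem sDegree_mapDomain {τ : Type*} (f : τ → σ) (a : σ → G) (α : τ →₀ ℕ) :
    sDegree a (α.mapDomain f) = sDegree (fun i => a (f i)) α :=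
  Finsupp.sum_mapDomain_index (fun _ => zero_smul _ _) (fun _ _ _ => add_smul _ _ _)

theorem sDegree_congr {a b : σ → G} {α : σ →₀ ℕ} (h : ∀ i, α i ≠ 0 → a i = b i) :
    sDegree a α = sDegree b α :=
  Finsupp.sum_congr fun i hi => by rw [h i (Finsupp.mem_support_iff.1 hi)]

theorem sDegree_eq_zero {a : σ → G} {α : σ →₀ ℕ} (h : ∀ i, α i ≠ 0 → a i = 0) :
    sDegree a α = 0 :=
  Finset.sum_eq_zero fun i hi => by
    simp only [h i (Finsupp.mem_support_iff.1 hi), smul_zero]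

theorem sDegree_indicator_of_subset {a : σ → G} {P : Set σ} {α : σ →₀ ℕ}
    (h : ∀ i, α i ≠ 0 → i ∈ P) : sDegree (P.indicator a) α = sDegree a α :=
  sDegree_congr fun i hi => Set.indicator_of_mem (h i hi) a

theorem sDegree_indicator_of_disjoint {a : σ → G} {P : Set σ} {α : σ →₀ ℕ}
    (h : ∀ i, α i ≠ 0 → i ∈ Pᶜ) : sDegree (P.indicator a) α = 0 :=
  sDegree_eq_zero fun i hi => Set.indicator_of_notMem (h i hi) a

theorem exists_restrict (P : Set σ) (α : σ →₀ ℕ) : ∃ α₁ α₂ : σ →₀ ℕ, α = α₁ + α₂ ∧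
    (∀ i, α₁ i ≠ 0 → i ∈ P) ∧ (∀ i, α₂ i ≠ 0 → i ∈ Pᶜ) := by
  classical
  refine ⟨α.filter (· ∈ P), α.filter (fun i => ¬ i ∈ P), (Finsupp.filter_add_filter_not _ _).symm,
    fun i hi => ?_, fun i hi => ?_⟩
  · by_contra h
    exact hi (Finsupp.filter_apply_neg _ _ h)
  · intro h
    exact hi (Finsupp.filter_apply_neg _ _ (not_not.2 h))

theorem exists_eq_single_add {α : σ →₀ ℕ} {i : σ} (hi : α i ≠ 0) :
    ∃ α' : σ →₀ ℕ, α = Finsupp.single i 1 + α' := by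
  refine ⟨α - Finsupp.single i 1, (add_tsub_cancel_of_le ?_).symm⟩
  exact Finsupp.single_le_iff.2 (Nat.one_le_iff_ne_zero.2 hi)

theorem mem_closure_image_iff {a : σ → G} {P : Set σ} {x : G} :
    x ∈ AddSubmonoid.closure (a '' P) ↔
      ∃ α : σ →₀ ℕ, (∀ i, α i ≠ 0 → i ∈ P) ∧ sDegree a α = x := by
  classical
  constructor
  · intro hx
    induction hx using AddSubmonoid.closure_induction with
    | mem x hx =>
      obtain ⟨i, hi, rfl⟩ := hx
      refine ⟨Finsupp.single i 1, fun j hj => ?_, sDegree_single_one a i⟩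
      rw [Finsupp.single_apply_ne_zero] at hj
      exact hj.1 ▸ hi
    | zero => exact ⟨0, fun i hi => absurd rfl hi, sDegree_zero a⟩
    | add x y _ _ hx hy =>
      obtain ⟨α, hα, rfl⟩ := hx
      obtain ⟨β, hβ, rfl⟩ := hy
      refine ⟨α + β, fun i hi => ?_, sDegree_add a α β⟩
      by_cases h : α i = 0
      · exact hβ i fun h' => hi (by simp [h, h'])
      · exact hα i h
  · rintro ⟨α, hα, rfl⟩
    exact sum_mem fun i hi => nsmul_mem
      (AddSubmonoid.subset_closure (Set.mem_image_of_mem a (hα i (Finsupp.mem_support_iff.1 hi)))) _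

theorem mem_closure_range_iff_sDegree {a : σ → G} {x : G} :
    x ∈ AddSubmonoid.closure (Set.range a) ↔ ∃ α : σ →₀ ℕ, sDegree a α = x := by
  rw [← Set.image_univ, mem_closure_image_iff]
  simp

theorem sDegree_mem_closure (a : σ → G) (α : σ →₀ ℕ) :
    sDegree a α ∈ AddSubmonoid.closure (Set.range a) :=
  mem_closure_range_iff_sDegree.2 ⟨α, rfl⟩

theorem eq_zero_of_sDegree_eq_zero {a : σ → G} (ha : ∀ i, a i ≠ 0)
    (hS : ∀ x ∈ AddSubmonoid.closure (Set.range a),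
      -x ∈ AddSubmonoid.closure (Set.range a) → x = 0)
    {α : σ →₀ ℕ} (h : sDegree a α = 0) : α = 0 := by
  by_contra hne
  obtain ⟨i, hi⟩ := Finsupp.ne_iff.1 hne
  obtain ⟨α', rfl⟩ := exists_eq_single_add hi
  rw [sDegree_add, sDegree_single_one] at h
  refine ha i (hS _ (AddSubmonoid.subset_closure ⟨i, rfl⟩) ?_)
  rw [neg_eq_of_add_eq_zero_right h]
  exact sDegree_mem_closure a α'

/-- If one monomial of degree `m` divides another, the quotient has degree `0`, hence is `1`. The
fibre is thus an antichain, finite by Dickson's lemma. -/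
theorem finite_fiber [Finite σ] {a : σ → G} (hpos : ∀ α : σ →₀ ℕ, sDegree a α = 0 → α = 0)
    (m : G) : {α : σ →₀ ℕ | sDegree a α = m}.Finite := by
  have : IsAntichain (· ≤ ·) {α : σ →₀ ℕ | sDegree a α = m} := by
    intro α hα β hβ hne hle
    obtain ⟨γ, rfl⟩ := exists_add_of_le hle
    have hα : sDegree a α = m := hα
    have hβ : sDegree a (α + γ) = m := hβ
    rw [sDegree_add, hα, add_eq_left] at hβ
    exact hne (by rw [hpos γ hβ, add_zero])
  exact WellQuasiOrderedLE.finite_of_isAntichain this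

/-- Induction on the degree: it suffices to pass from the degrees `m - aᵢ`, where `Xᵢ` divides some
monomial of degree `m`, to the degree `m`. -/
theorem sDegree_induction [Finite σ] {a : σ → G}
    (hpos : ∀ α : σ →₀ ℕ, sDegree a α = 0 → α = 0) {p : G → Prop}
    (step : ∀ m, (∀ (i : σ) (α : σ →₀ ℕ), a i + sDegree a α = m → p (sDegree a α)) → p m)
    (m : G) : p m := by
  -- Here `N` strictly bounds the total degrees of all monomials in the fibre of `m`; removing one
  -- variable lowers the bound by one. For `N = 0` the fibre is empty and `step` applies vacuously.
  have key : ∀ (N : ℕ) (m : G),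
      (∀ α : σ →₀ ℕ, sDegree a α = m → α.degree < N) → p m := by
    intro N
    induction N with
    | zero =>
      refine fun m hm => step m fun i α h => ?_
      have := hm (Finsupp.single i 1 + α) (by rw [sDegree_add, sDegree_single_one, h])
      exact absurd this (Nat.not_lt_zero _)
    | succ N ih =>
      refine fun m hm => step m fun i α h => ih _ fun β hβ => ?_
      have := hm (Finsupp.single i 1 + β) (by rw [sDegree_add, sDegree_single_one, hβ, h])
      rw [map_add, Finsupp.degree_single] at this
      omega
  obtain ⟨N, hN⟩ := ((finite_fiber hpos m).image Finsupp.degree).bddAbove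
  exact key (N + 1) m fun α hα => Nat.lt_succ_of_le (hN ⟨α, hα, rfl⟩)

end SemigroupDegree

/-! ### The complexes `∇_m` and `Δ_m`. -/

section Complexes

variable {σ G : Type*} [AddCommGroup G]

theorem mem_vertices_nablaComplex {a : σ → G} {m : G} {α : σ →₀ ℕ} :
    α ∈ complexVertices (nablaComplex a m) ↔ sDegree a α = m ∧ α ≠ 0 := by
  simp [complexVertices, nablaComplex]

theorem adj_nablaComplex_iff {a : σ → G} {m : G} {α β : σ →₀ ℕ} :
    (∃ F ∈ (nablaComplex a m).faces, α ∈ F ∧ β ∈ F) ↔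
      sDegree a α = m ∧ sDegree a β = m ∧ ∃ i, α i ≠ 0 ∧ β i ≠ 0 := by
  classical
  constructor
  · rintro ⟨F, ⟨hF, hne, hgcd⟩, hα, hβ⟩
    obtain ⟨i, hi⟩ := Finsupp.ne_iff.1 hgcd
    refine ⟨hF α hα, hF β hβ, i, fun h => hi ?_, fun h => hi ?_⟩
    · exact Nat.le_zero.1 (h ▸ Finset.inf'_le id hα i)
    · exact Nat.le_zero.1 (h ▸ Finset.inf'_le id hβ i)
  · rintro ⟨hα, hβ, i, hi, hi'⟩
    refine ⟨{α, β}, ⟨by simp [hα, hβ], by simp, fun h => ?_⟩, by simp, by simp⟩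
    have hle : Finsupp.single i 1 ≤ Finset.inf' {α, β} (by simp) (id : (σ →₀ ℕ) → _) := by
      refine Finset.le_inf' _ _ fun γ hγ => Finsupp.single_le_iff.2 (Nat.one_le_iff_ne_zero.2 ?_)
      rcases Finset.mem_insert.1 hγ with rfl | hγ
      · exact hi
      · exact Finset.mem_singleton.1 hγ ▸ hi'
    rw [h] at hle
    simpa using hle i

theorem mem_faces_deltaComplex {a : σ → G} {m : G} {F : Finset σ} :
    F ∈ (deltaComplex a m).faces ↔
      F.Nonempty ∧ ∃ α : σ →₀ ℕ, sDegree a α = m ∧ ∀ i ∈ F, α i ≠ 0 := by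
  classical
  have hsum : sDegree a (∑ i ∈ F, Finsupp.single i 1) = ∑ i ∈ F, a i := by
    induction F using Finset.induction_on with
    | empty => simp [sDegree_zero]
    | insert i F hi ih => rw [Finset.sum_insert hi, Finset.sum_insert hi, sDegree_add, ih,
        sDegree_single_one]
  have happ : ∀ i ∈ F, (∑ j ∈ F, Finsupp.single j 1 : σ →₀ ℕ) i = 1 := by
    intro i hi
    rw [Finsupp.finsetSum_apply, Finset.sum_eq_single i] <;> simp +contextual [hi]
  have happ' : ∀ i ∉ F, (∑ j ∈ F, Finsupp.single j 1 : σ →₀ ℕ) i = 0 := by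
    intro i hi
    rw [Finsupp.finsetSum_apply]
    refine Finset.sum_eq_zero fun j hj => Finsupp.single_eq_of_ne ?_
    rintro rfl
    exact hi hj
  refine and_congr_right fun _ => ?_
  rw [mem_closure_range_iff_sDegree]
  constructor
  · rintro ⟨β, hβ⟩
    refine ⟨(∑ i ∈ F, Finsupp.single i 1) + β, by rw [sDegree_add, hsum, hβ]; abel, fun i hi => ?_⟩
    rw [Finsupp.add_apply, happ i hi]
    omega
  · rintro ⟨α, rfl, hα⟩
    have hle : (∑ i ∈ F, Finsupp.single i 1) ≤ α := by
      intro i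
      by_cases hi : i ∈ F
      · rw [happ i hi]
        exact Nat.one_le_iff_ne_zero.2 (hα i hi)
      · rw [happ' i hi]
        exact Nat.zero_le _
    obtain ⟨β, rfl⟩ := exists_add_of_le hle
    exact ⟨β, by rw [sDegree_add, hsum]; abel⟩

theorem mem_vertices_deltaComplex {a : σ → G} {m : G} {i : σ} :
    i ∈ complexVertices (deltaComplex a m) ↔ ∃ α : σ →₀ ℕ, sDegree a α = m ∧ α i ≠ 0 := by
  simp [complexVertices, mem_faces_deltaComplex]

theorem adj_deltaComplex_iff {a : σ → G} {m : G} {i j : σ} :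
    (∃ F ∈ (deltaComplex a m).faces, i ∈ F ∧ j ∈ F) ↔
      ∃ α : σ →₀ ℕ, sDegree a α = m ∧ α i ≠ 0 ∧ α j ≠ 0 := by
  classical
  simp only [mem_faces_deltaComplex]
  constructor
  · rintro ⟨F, ⟨-, α, hα, hF⟩, hi, hj⟩
    exact ⟨α, hα, hF i hi, hF j hj⟩
  · rintro ⟨α, hα, hi, hj⟩
    exact ⟨{i, j}, ⟨by simp, α, hα, by simp [hi, hj]⟩, by simp, by simp⟩

/-- Both sides express connectedness of the bipartite graph joining each monomial of degree `m` to
the variables dividing it: monomials are adjacent through a common variable, variables through a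
common monomial. -/
theorem isConnectedComplex_nabla_iff_delta {a : σ → G} {m : G} :
    IsConnectedComplex (nablaComplex a m) ↔ IsConnectedComplex (deltaComplex a m) := by
  simp only [IsConnectedComplex, adj_nablaComplex_iff, adj_deltaComplex_iff,
    mem_vertices_nablaComplex, mem_vertices_deltaComplex]
  constructor
  · rintro h i ⟨α, hα, hi⟩ j ⟨β, hβ, hj⟩
    have hpath := h α ⟨hα, fun h => hi (by simp [h])⟩ β ⟨hβ, fun h => hj (by simp [h])⟩
    clear h
    induction hpath generalizing j with
    | refl => exact .single ⟨α, hα, hi, hj⟩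
    | tail _ hstep ih =>
      obtain ⟨hγ, -, l, hl, hl'⟩ := hstep
      exact (ih l hγ hl).tail ⟨_, hβ, hl', hj⟩
  · rintro h α ⟨hα, hα0⟩ β ⟨hβ, hβ0⟩
    obtain ⟨i, hi⟩ := Finsupp.ne_iff.1 hα0
    obtain ⟨j, hj⟩ := Finsupp.ne_iff.1 hβ0
    have hpath := h i ⟨α, hα, hi⟩ j ⟨β, hβ, hj⟩
    clear h hβ0
    induction hpath generalizing β with
    | refl => exact .single ⟨hα, hβ, i, hi, hj⟩
    | tail _ hstep ih =>
      obtain ⟨γ, hγ, hl, hl'⟩ := hstep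
      exact (ih γ hγ hl).tail ⟨hγ, hβ, _, hl', hj⟩

/-- All monomials of `S`-degree `m` only involve indeterminates with index in `P`. -/
def FiberSupportedIn (a : σ → G) (m : G) (P : Set σ) : Prop :=
  ∀ α : σ →₀ ℕ, sDegree a α = m → ∀ i, α i ≠ 0 → i ∈ P

theorem vertices_deltaComplex_subset_iff {a : σ → G} {m : G} {P : Set σ} :
    complexVertices (deltaComplex a m) ⊆ P ↔ FiberSupportedIn a m P := by
  simp only [Set.subset_def, mem_vertices_deltaComplex, FiberSupportedIn]
  exact ⟨fun h α hα i hi => h i ⟨α, hα, hi⟩, fun h i ⟨α, hα, hi⟩ => h α hα i hi⟩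

theorem nablaVerticesIn_iff {k : Type*} [Field k] {a : σ → G} {m : G} {C : Set G} :
    NablaVerticesIn k a m C ↔ FiberSupportedIn a m (a ⁻¹' C) := by
  simp only [NablaVerticesIn, mem_vertices_nablaComplex, MvPolynomial.mem_supported,
    MvPolynomial.vars_monomial (one_ne_zero : (1 : k) ≠ 0), FiberSupportedIn]
  constructor
  · intro h α hα i hi
    exact h α ⟨hα, fun h => hi (by simp [h])⟩ (Finsupp.mem_support_iff.2 hi)
  · intro h α hα i hi
    exact h α hα.1 i (Finsupp.mem_support_iff.1 hi)

end Complexes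

/-! ### Splitting of degrees versus disconnected complexes. -/

section Splitting

theorem sdiff_eq_of_disjoint_of_eq_union {τ : Type*} {s C D : Set τ} (hd : Disjoint C D)
    (hs : s = C ∪ D) : s \ C = D := by
  rw [hs, Set.union_sdiff_left, hd.symm.sdiff_eq_left]

variable {σ G : Type*} [AddCommGroup G]

/-- The degree of the part of a monomial that lies in the indeterminates with index in `P` only
depends on the degree of the monomial. -/
def SplitsAlong (a : σ → G) (P : Set σ) : Prop :=
  ∀ α β : σ →₀ ℕ, sDegree a α = sDegree a β →
    sDegree (P.indicator a) α = sDegree (P.indicator a) β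

/-- There is a nontrivial relation between the generators with index in `P`. -/
def HasRelationIn (a : σ → G) (P : Set σ) : Prop :=
  ∃ α β : σ →₀ ℕ, α ≠ β ∧ (∀ i, α i ≠ 0 → i ∈ P) ∧ (∀ i, β i ≠ 0 → i ∈ P) ∧
    sDegree a α = sDegree a β

/-- The index set `P` and its complement separate the degrees with disconnected complexes, and both
of them contain the support of such a degree. -/
def SeparatesDisconnected (a : σ → G) (P : Set σ) : Prop :=
  (∀ m ∈ AddSubmonoid.closure (Set.range a), ¬ IsConnectedComplex (nablaComplex a m) →
    FiberSupportedIn a m P ∨ FiberSupportedIn a m Pᶜ) ∧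
  ∃ m₁ ∈ AddSubmonoid.closure (Set.range a), ∃ m₂ ∈ AddSubmonoid.closure (Set.range a),
    ¬ IsConnectedComplex (nablaComplex a m₁) ∧ ¬ IsConnectedComplex (nablaComplex a m₂) ∧
    FiberSupportedIn a m₁ P ∧ FiberSupportedIn a m₂ Pᶜ

theorem sDegree_indicator_add_compl (a : σ → G) (P : Set σ) (α : σ →₀ ℕ) :
    sDegree (P.indicator a) α + sDegree (Pᶜ.indicator a) α = sDegree a α := by
  obtain ⟨α₁, α₂, rfl, h₁, h₂⟩ := exists_restrict P α
  rw [sDegree_add, sDegree_add, sDegree_add, sDegree_indicator_of_subset h₁,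
    sDegree_indicator_of_subset h₂, sDegree_indicator_of_disjoint h₂,
    sDegree_indicator_of_disjoint (P := Pᶜ) (by simpa using h₁), zero_add, add_zero]

theorem SplitsAlong.compl {a : σ → G} {P : Set σ} (h : SplitsAlong a P) : SplitsAlong a Pᶜ := by
  intro α β hαβ
  have h' := h α β hαβ
  rw [← sDegree_indicator_add_compl a P α, ← sDegree_indicator_add_compl a P β, h'] at hαβ
  exact add_left_cancel hαβ

theorem HasRelationIn.nonempty {a : σ → G} {P : Set σ} (h : HasRelationIn a P) : P.Nonempty := by
  obtain ⟨α, β, hne, hα, hβ, -⟩ := h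
  obtain ⟨i, hi⟩ := Finsupp.ne_iff.1 hne
  by_cases h : α i = 0
  · exact ⟨i, hβ i fun h' => hi (h.trans h'.symm)⟩
  · exact ⟨i, hα i h⟩

theorem HasRelationIn.mono {a : σ → G} {P Q : Set σ} (h : HasRelationIn a P) (hPQ : P ⊆ Q) :
    HasRelationIn a Q := by
  obtain ⟨α, β, hne, hα, hβ, h⟩ := h
  exact ⟨α, β, hne, fun i hi => hPQ (hα i hi), fun i hi => hPQ (hβ i hi), h⟩

theorem SplitsAlong.mem_of_eq {a : σ → G} {P : Set σ} (h : SplitsAlong a P) (ha : ∀ i, a i ≠ 0)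
    {i j : σ} (hij : a i = a j) (hi : i ∈ P) : j ∈ P := by
  by_contra hj
  have := h (Finsupp.single i 1) (Finsupp.single j 1) (by simpa [sDegree_single_one] using hij)
  rw [sDegree_single_one, sDegree_single_one, Set.indicator_of_mem hi,
    Set.indicator_of_notMem hj] at this
  exact ha i this

/-- The family `a` may repeat values, but equal generators lie on the same side of `P`, so index
sets can be exchanged for sets of generators. -/
theorem SplitsAlong.preimage_image {a : σ → G} {P : Set σ} (h : SplitsAlong a P)
    (ha : ∀ i, a i ≠ 0) : a ⁻¹' (a '' P) = P := by
  refine (Set.subset_preimage_image a P).antisymm' ?_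
  rintro j ⟨i, hi, hij⟩
  exact h.mem_of_eq ha hij hi

/-- The `Pᶜ`-part of any monomial in the fibre has the same degree as that of `α`, namely `0`, so it
is trivial by `hpos`. -/
theorem SplitsAlong.fiberSupportedIn {a : σ → G} {P : Set σ} (h : SplitsAlong a P)
    (hpos : ∀ α : σ →₀ ℕ, sDegree a α = 0 → α = 0) {α : σ →₀ ℕ} (hα : ∀ i, α i ≠ 0 → i ∈ P) :
    FiberSupportedIn a (sDegree a α) P := by
  intro γ hγ i hi
  by_contra hiP
  have h1 := h.compl γ α hγ
  rw [sDegree_indicator_of_disjoint (P := Pᶜ) (α := α) (by simpa using hα)] at h1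
  obtain ⟨γ₁, γ₂, rfl, h₁, h₂⟩ := exists_restrict P γ
  rw [sDegree_add, sDegree_indicator_of_disjoint (P := Pᶜ) (by simpa using h₁),
    sDegree_indicator_of_subset h₂, zero_add] at h1
  rw [hpos γ₂ h1, add_zero] at hi
  exact hiP (h₁ i hi)

/-- If the complex of a degree `m` is connected, a relation of degree `m` comes from relations
of smaller degree. -/
theorem exists_common_of_connected {a : σ → G} {m : G}
    (hconn : IsConnectedComplex (nablaComplex a m))
    (hpos : ∀ α : σ →₀ ℕ, sDegree a α = 0 → α = 0) {r : (σ →₀ ℕ) → (σ →₀ ℕ) → Prop}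
    (hrefl : ∀ α, r α α) (htrans : ∀ α β γ, r α β → r β γ → r α γ)
    (hstep : ∀ i α β, a i + sDegree a α = m → sDegree a α = sDegree a β →
      r (Finsupp.single i 1 + α) (Finsupp.single i 1 + β))
    {α β : σ →₀ ℕ} (hα : sDegree a α = m) (hβ : sDegree a β = m) : r α β := by
  -- The monomial `1` is not a vertex of `∇_m`, so it is treated apart; by `hpos` it is alone in its
  -- fibre.
  by_cases hα0 : α = 0
  · rw [hα0, sDegree_zero] at hα
    rw [hα0, hpos β (hβ.trans hα.symm)]
    exact hrefl 0
  by_cases hβ0 : β = 0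
  · rw [hβ0, sDegree_zero] at hβ
    exact absurd (hpos α (hα.trans hβ.symm)) hα0
  have hpath := hconn α (mem_vertices_nablaComplex.2 ⟨hα, hα0⟩) β
    (mem_vertices_nablaComplex.2 ⟨hβ, hβ0⟩)
  clear hβ hβ0
  induction hpath with
  | refl => exact hrefl α
  | tail _ h ih =>
    refine htrans _ _ _ ih ?_
    obtain ⟨hγ, hδ, i, hi, hi'⟩ := adj_nablaComplex_iff.1 h
    obtain ⟨γ, rfl⟩ := exists_eq_single_add hi
    obtain ⟨δ, rfl⟩ := exists_eq_single_add hi'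
    rw [sDegree_add, sDegree_single_one] at hγ hδ
    exact hstep i γ δ hγ (add_left_cancel (hγ.trans hδ.symm))

/-- Induction on the degree: in a connected degree a common variable cancels along each edge; in a
disconnected one all `P`-parts have degree `m`, or all have degree `0`. -/
theorem splitsAlong_of_fiberSupportedIn [Finite σ] {a : σ → G} {P : Set σ}
    (hpos : ∀ α : σ →₀ ℕ, sDegree a α = 0 → α = 0)
    (h : ∀ m ∈ AddSubmonoid.closure (Set.range a), ¬ IsConnectedComplex (nablaComplex a m) →
      FiberSupportedIn a m P ∨ FiberSupportedIn a m Pᶜ) : SplitsAlong a P := by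
  suffices ∀ m, ∀ α β : σ →₀ ℕ, sDegree a α = m → sDegree a β = m →
      sDegree (P.indicator a) α = sDegree (P.indicator a) β from
    fun α β hαβ => this _ α β rfl hαβ.symm
  intro m
  induction m using sDegree_induction hpos with
  | step m ih =>
  intro α β hα hβ
  by_cases hconn : IsConnectedComplex (nablaComplex a m)
  · refine exists_common_of_connected hconn hpos
      (r := fun α β => sDegree (P.indicator a) α = sDegree (P.indicator a) β)
      (fun _ => rfl) (fun _ _ _ => Eq.trans) ?_ hα hβ
    intro i γ δ hγ hγδ
    rw [sDegree_add, sDegree_add, ih i γ hγ γ δ rfl hγδ.symm]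
  · rcases h m (hα ▸ sDegree_mem_closure a α) hconn with h | h
    · rw [sDegree_indicator_of_subset (h α hα), sDegree_indicator_of_subset (h β hβ), hα, hβ]
    · rw [sDegree_indicator_of_disjoint (h α hα), sDegree_indicator_of_disjoint (h β hβ)]

theorem hasRelationIn_of_not_connected {a : σ → G} {P : Set σ} {m : G}
    (hm : ¬ IsConnectedComplex (nablaComplex a m)) (h : FiberSupportedIn a m P) :
    HasRelationIn a P := by
  simp only [IsConnectedComplex, not_forall] at hm
  obtain ⟨α, hα, β, hβ, hαβ⟩ := hm
  rw [mem_vertices_nablaComplex] at hα hβ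
  refine ⟨α, β, ?_, h α hα.1, h β hβ.1, hα.1.trans hβ.1.symm⟩
  rintro rfl
  exact hαβ .refl

/-- If every degree supported in `P` were connected, cancelling common variables would show by
induction that each such fibre has at most one monomial, against the given relation. -/
theorem SplitsAlong.exists_not_connected [Finite σ] {a : σ → G} {P : Set σ}
    (h : SplitsAlong a P) (hpos : ∀ α : σ →₀ ℕ, sDegree a α = 0 → α = 0)
    (hP : HasRelationIn a P) :
    ∃ m ∈ AddSubmonoid.closure (Set.range a), ¬ IsConnectedComplex (nablaComplex a m) ∧
      FiberSupportedIn a m P := by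
  by_contra! hcon
  suffices ∀ m, FiberSupportedIn a m P → ∀ α β : σ →₀ ℕ, sDegree a α = m → sDegree a β = m →
      α = β by
    obtain ⟨α, β, hne, hα, -, hαβ⟩ := hP
    exact hne (this _ (h.fiberSupportedIn hpos hα) α β rfl hαβ.symm)
  intro m
  induction m using sDegree_induction hpos with
  | step m ih =>
  intro hm α β hα hβ
  have hconn : IsConnectedComplex (nablaComplex a m) :=
    of_not_not fun hc => hcon m (hα ▸ sDegree_mem_closure a α) hc hm
  refine exists_common_of_connected hconn hpos (r := Eq) (fun _ => rfl) (fun _ _ _ => Eq.trans) ?_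
    hα hβ
  intro i γ δ hγ hγδ
  rw [ih i γ hγ (fun ε hε j hj => ?_) γ δ rfl hγδ.symm]
  refine hm (Finsupp.single i 1 + ε) (by rw [sDegree_add, sDegree_single_one, hε, hγ]) j ?_
  rw [Finsupp.add_apply]
  omega

/-- Otherwise every monomial of degree `m` involves both sides. For `α`, `β` in the fibre, the
`P`-part of `α` times the `Pᶜ`-part of `β` again has degree `m` and shares a variable with each,
giving a path of length two. -/
theorem SplitsAlong.fiberSupportedIn_or {a : σ → G} {P : Set σ} (h : SplitsAlong a P)
    (hpos : ∀ α : σ →₀ ℕ, sDegree a α = 0 → α = 0)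
    {m : G} (hm : ¬ IsConnectedComplex (nablaComplex a m)) :
    FiberSupportedIn a m P ∨ FiberSupportedIn a m Pᶜ := by
  by_contra! hcon
  have hin : ∀ α : σ →₀ ℕ, sDegree a α = m → ¬ ∀ i, α i ≠ 0 → i ∈ P := by
    rintro α rfl hα
    exact hcon.1 (h.fiberSupportedIn hpos hα)
  have hout : ∀ α : σ →₀ ℕ, sDegree a α = m → ¬ ∀ i, α i ≠ 0 → i ∈ Pᶜ := by
    rintro α rfl hα
    exact hcon.2 (h.compl.fiberSupportedIn hpos hα)
  refine hm fun α hα β hβ => ?_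
  simp only [adj_nablaComplex_iff]
  rw [mem_vertices_nablaComplex] at hα hβ
  obtain ⟨hα, -⟩ := hα
  obtain ⟨hβ, -⟩ := hβ
  have hαβ := h α β (hα.trans hβ.symm)
  have hα' := hout α hα
  have hβ' := hin β hβ
  obtain ⟨α₁, α₂, rfl, hα₁, hα₂⟩ := exists_restrict P α
  obtain ⟨β₁, β₂, rfl, hβ₁, hβ₂⟩ := exists_restrict P β
  rw [sDegree_add, sDegree_add, sDegree_indicator_of_subset hβ₁,
    sDegree_indicator_of_subset hα₁, sDegree_indicator_of_disjoint hβ₂,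
    sDegree_indicator_of_disjoint hα₂, add_zero, add_zero] at hαβ
  have hmid : sDegree a (α₁ + β₂) = m := by rw [← hβ, sDegree_add, sDegree_add, hαβ]
  have hα₁0 : α₁ ≠ 0 := by
    rintro rfl
    exact hα' (by simpa using hα₂)
  have hβ₂0 : β₂ ≠ 0 := by
    rintro rfl
    exact hβ' (by simpa using hβ₁)
  obtain ⟨i, hi⟩ := Finsupp.ne_iff.1 hα₁0
  obtain ⟨j, hj⟩ := Finsupp.ne_iff.1 hβ₂0
  simp only [Finsupp.coe_zero, Pi.zero_apply] at hi hj
  refine .tail (.single ⟨hα, hmid, i, ?_, ?_⟩) ⟨hmid, hβ, j, ?_, ?_⟩ <;>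
    rw [Finsupp.add_apply] <;> omega

theorem splitsAlong_iff_separatesDisconnected [Finite σ] {a : σ → G} {P : Set σ}
    (hpos : ∀ α : σ →₀ ℕ, sDegree a α = 0 → α = 0) :
    SplitsAlong a P ∧ HasRelationIn a P ∧ HasRelationIn a Pᶜ ↔ SeparatesDisconnected a P := by
  constructor
  · rintro ⟨h, h₁, h₂⟩
    refine ⟨fun m _ => h.fiberSupportedIn_or hpos, ?_⟩
    obtain ⟨m₁, hm₁, hc₁, hs₁⟩ := h.exists_not_connected hpos h₁
    obtain ⟨m₂, hm₂, hc₂, hs₂⟩ := h.compl.exists_not_connected hpos h₂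
    exact ⟨m₁, hm₁, m₂, hm₂, hc₁, hc₂, hs₁, hs₂⟩
  · rintro ⟨h, m₁, -, m₂, -, hc₁, hc₂, hs₁, hs₂⟩
    exact ⟨splitsAlong_of_fiberSupportedIn hpos h, hasRelationIn_of_not_connected hc₁ hs₁,
      hasRelationIn_of_not_connected hc₂ hs₂⟩

end Splitting

/-! ### Semigroup ideals and decompositions. -/

section Ideals

variable {k : Type*} [Field k] {σ G : Type*} [AddCommGroup G]

open MvPolynomial

theorem sub_mem_semigroupIdeal {a : σ → G} {α β : σ →₀ ℕ} (h : sDegree a α = sDegree a β) :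
    monomial α (1 : k) - monomial β 1 ∈ semigroupIdeal k a :=
  Ideal.subset_span ⟨α, β, h, rfl⟩

theorem aeval_single_monomial (a : σ → G) (α : σ →₀ ℕ) :
    aeval (fun i => (AddMonoidAlgebra.single (a i) 1 : AddMonoidAlgebra k G)) (monomial α (1 : k)) =
      AddMonoidAlgebra.single (sDegree a α) 1 := by
  rw [aeval_monomial, map_one, one_mul]
  induction α using Finsupp.induction_linear with
  | zero => simp [sDegree_zero, AddMonoidAlgebra.one_def]
  | add α β hα hβ =>
    rw [Finsupp.prod_add_index' (by simp) (fun _ _ _ => pow_add _ _ _), hα, hβ, sDegree_add,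
      AddMonoidAlgebra.single_mul_single, one_mul]
  | single i c =>
    rw [Finsupp.prod_single_index (by simp), sDegree_single, AddMonoidAlgebra.single_pow, one_pow]

/-- The ideal is killed by the map to the group algebra of `G` sending `Xᵢ` to the basis element of
`a i`, and distinct degrees give distinct basis elements. -/
theorem sub_mem_semigroupIdeal_iff {a : σ → G} {α β : σ →₀ ℕ} :
    monomial α (1 : k) - monomial β 1 ∈ semigroupIdeal k a ↔ sDegree a α = sDegree a β := by
  refine ⟨fun h => ?_, sub_mem_semigroupIdeal⟩
  let φ : MvPolynomial σ k →ₐ[k] AddMonoidAlgebra k G :=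
    aeval fun i => AddMonoidAlgebra.single (a i) 1
  have hφ : ∀ α, φ (monomial α 1) = AddMonoidAlgebra.single (sDegree a α) 1 :=
    aeval_single_monomial a
  have hle : semigroupIdeal k a ≤ RingHom.ker φ := by
    refine Ideal.span_le.2 ?_
    rintro _ ⟨α, β, h, rfl⟩
    rw [SetLike.mem_coe, RingHom.mem_ker, map_sub, hφ, hφ, h, sub_self]
  have h0 := hle h
  rw [RingHom.mem_ker, map_sub, hφ, hφ, sub_eq_zero] at h0
  exact AddMonoidAlgebra.single_left_injective one_ne_zero h0

theorem extendedSubsemigroupIdeal_le {a : σ → G} {B : Set G} {J : Ideal (MvPolynomial σ k)}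
    (h : ∀ α β : σ →₀ ℕ, (∀ i, α i ≠ 0 → a i ∈ B) → (∀ i, β i ≠ 0 → a i ∈ B) →
      sDegree a α = sDegree a β → monomial α (1 : k) - monomial β 1 ∈ J) :
    extendedSubsemigroupIdeal k a B ≤ J := by
  classical
  refine Ideal.map_le_iff_le_comap.2 (Ideal.span_le.2 ?_)
  rintro _ ⟨α, β, hαβ, rfl⟩
  have hsupp : ∀ (γ : {i : σ // a i ∈ B} →₀ ℕ) (i : σ), γ.mapDomain Subtype.val i ≠ 0 →
      a i ∈ B := by
    intro γ i hi
    by_contra hiB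
    exact hi (Finsupp.mapDomain_of_notMem_range _ _ (by simpa using hiB))
  rw [SetLike.mem_coe, Ideal.mem_comap, map_sub, rename_monomial, rename_monomial]
  refine h _ _ (hsupp α) (hsupp β) ?_
  rw [sDegree_mapDomain, sDegree_mapDomain]
  exact hαβ

theorem exists_mapDomain_val_eq {p : σ → Prop} {α : σ →₀ ℕ} (hα : ∀ i, α i ≠ 0 → p i) :
    ∃ α' : {i // p i} →₀ ℕ, α'.mapDomain Subtype.val = α := by
  classical
  refine ⟨α.comapDomain Subtype.val Subtype.val_injective.injOn,
    Finsupp.mapDomain_comapDomain _ Subtype.val_injective _ fun i hi => ?_⟩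
  simpa using hα i (Finsupp.mem_support_iff.1 hi)

theorem sub_mem_extendedSubsemigroupIdeal {a : σ → G} {B : Set G} {α β : σ →₀ ℕ}
    (hα : ∀ i, α i ≠ 0 → a i ∈ B) (hβ : ∀ i, β i ≠ 0 → a i ∈ B)
    (h : sDegree a α = sDegree a β) :
    monomial α (1 : k) - monomial β 1 ∈ extendedSubsemigroupIdeal k a B := by
  obtain ⟨α, rfl⟩ := exists_mapDomain_val_eq hα
  obtain ⟨β, rfl⟩ := exists_mapDomain_val_eq hβ
  rw [sDegree_mapDomain, sDegree_mapDomain] at h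
  rw [← rename_monomial, ← rename_monomial, ← map_sub]
  exact Ideal.mem_map_of_mem _ (sub_mem_semigroupIdeal h)

theorem semigroupIdeal_eq_bot_iff {a : σ → G} :
    semigroupIdeal k a = ⊥ ↔ Function.Injective (sDegree a) := by
  rw [semigroupIdeal, Ideal.span_eq_bot]
  constructor
  · intro h α β hαβ
    exact monomial_left_injective one_ne_zero (sub_eq_zero.1 (h _ ⟨α, β, hαβ, rfl⟩))
  · rintro h _ ⟨α, β, hαβ, rfl⟩
    rw [h hαβ, sub_self]

theorem subsemigroupIdeal_ne_bot_iff {a : σ → G} {B : Set G} :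
    subsemigroupIdeal k a B ≠ ⊥ ↔ HasRelationIn a (a ⁻¹' B) := by
  rw [subsemigroupIdeal, Ne, semigroupIdeal_eq_bot_iff, Function.Injective]
  push Not
  constructor
  · rintro ⟨α, β, hαβ, hne⟩
    have hsupp : ∀ (γ : {i : σ // a i ∈ B} →₀ ℕ) (i : σ), γ.mapDomain Subtype.val i ≠ 0 →
        i ∈ a ⁻¹' B := by
      intro γ i hi
      by_contra hiB
      exact hi (Finsupp.mapDomain_of_notMem_range _ _ (by simpa using hiB))
    refine ⟨α.mapDomain Subtype.val, β.mapDomain Subtype.val,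
      fun h => hne (Finsupp.mapDomain_injective Subtype.val_injective h), hsupp α, hsupp β, ?_⟩
    rw [sDegree_mapDomain, sDegree_mapDomain]
    exact hαβ
  · rintro ⟨α, β, hne, hα, hβ, h⟩
    obtain ⟨α, rfl⟩ := exists_mapDomain_val_eq (p := fun i => a i ∈ B) hα
    obtain ⟨β, rfl⟩ := exists_mapDomain_val_eq (p := fun i => a i ∈ B) hβ
    rw [sDegree_mapDomain, sDegree_mapDomain] at h
    exact ⟨α, β, h, fun h' => hne (by rw [h'])⟩

theorem IsDecomposable.exists_splitsAlong {a : σ → G} (ha : ∀ i, a i ≠ 0)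
    (h : IsDecomposable k a) :
    ∃ P : Set σ, SplitsAlong a P ∧ HasRelationIn a P ∧ HasRelationIn a Pᶜ := by
  classical
  obtain ⟨t, A, ht, hA, -, hsum, hideal, hne⟩ := h
  -- A generator in both sets could be placed in either summand, against uniqueness, since it is
  -- nonzero.
  have hdisj : ∀ i j, i ≠ j → ∀ l, a l ∈ A i → a l ∉ A j := by
    intro i j hij l hi hj
    obtain ⟨s, -, hs⟩ := hsum (a l) (AddSubmonoid.subset_closure ⟨l, rfl⟩)
    have key : ∀ i, a l ∈ A i → Pi.single i (a l) = s := fun i hi => by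
      refine hs _ ⟨fun j => ?_, Finset.sum_pi_single' i (a l) Finset.univ |>.trans (by simp)⟩
      by_cases hji : j = i
      · subst hji
        rw [Pi.single_eq_same]
        exact AddSubmonoid.subset_closure hi
      · rw [Pi.single_eq_of_ne hji]
        exact zero_mem _
    have := congrFun ((key i hi).trans (key j hj).symm) i
    rw [Pi.single_eq_same, Pi.single_eq_of_ne hij] at this
    exact ha l this
  let i₀ : Fin t := ⟨0, by omega⟩
  let i₁ : Fin t := ⟨1, by omega⟩
  have h01 : i₁ ≠ i₀ := by simp [i₀, i₁]
  refine ⟨a ⁻¹' A i₀, fun α β hαβ => ?_, subsemigroupIdeal_ne_bot_iff.1 (hne i₀),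
    (subsemigroupIdeal_ne_bot_iff.1 (hne i₁)).mono fun l hl => hdisj i₁ i₀ h01 l hl⟩
  -- The goal becomes membership in the ideal of the indicator family, which contains every summand:
  -- on `A i₀` the degree is unchanged, on the other sets it vanishes.
  rw [← sub_mem_semigroupIdeal_iff (k := k)] at hαβ ⊢
  rw [hideal] at hαβ
  refine iSup_le (fun i => extendedSubsemigroupIdeal_le fun γ δ hγ hδ hγδ =>
    sub_mem_semigroupIdeal ?_) hαβ
  by_cases hi : i = i₀
  · subst hi
    rwa [sDegree_indicator_of_subset (P := a ⁻¹' A i₀) hγ,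
      sDegree_indicator_of_subset (P := a ⁻¹' A i₀) hδ]
  · rw [sDegree_indicator_of_disjoint (P := a ⁻¹' A i₀) fun l hl => hdisj i i₀ hi l (hγ l hl),
      sDegree_indicator_of_disjoint (P := a ⁻¹' A i₀) fun l hl => hdisj i i₀ hi l (hδ l hl)]

theorem SplitsAlong.closure_ne {a : σ → G} {P : Set σ} (h : SplitsAlong a P)
    (ha : ∀ i, a i ≠ 0) (hP : Pᶜ.Nonempty) :
    AddSubmonoid.closure (a '' P) ≠ AddSubmonoid.closure (Set.range a) := by
  intro heq
  obtain ⟨i, hi⟩ := hP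
  have hmem : a i ∈ AddSubmonoid.closure (a '' P) := heq ▸ AddSubmonoid.subset_closure ⟨i, rfl⟩
  obtain ⟨β, hβ, hβi⟩ := mem_closure_image_iff.1 hmem
  have := h β (Finsupp.single i 1) (by rw [hβi, sDegree_single_one])
  rw [sDegree_indicator_of_subset hβ, sDegree_single_one, Set.indicator_of_notMem hi, hβi] at this
  exact ha i this

theorem SplitsAlong.isDecomposable {a : σ → G} {P : Set σ} (h : SplitsAlong a P)
    (ha : ∀ i, a i ≠ 0) (h₁ : HasRelationIn a P) (h₂ : HasRelationIn a Pᶜ) :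
    IsDecomposable k a := by
  have hP := h.preimage_image ha
  have hPc := h.compl.preimage_image ha
  refine ⟨2, ![a '' P, a '' Pᶜ], le_rfl, ?_, ?_, ?_, ?_, ?_⟩
  · simp [Fin.forall_fin_two]
  · simp only [Fin.forall_fin_two, Matrix.cons_val_zero, Matrix.cons_val_one]
    exact ⟨h.closure_ne ha h₂.nonempty, h.compl.closure_ne ha (by simpa using h₁.nonempty)⟩
  · intro x hx
    obtain ⟨α, rfl⟩ := mem_closure_range_iff_sDegree.1 hx
    obtain ⟨α₁, α₂, rfl, hα₁, hα₂⟩ := exists_restrict P α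
    refine ⟨![sDegree a α₁, sDegree a α₂], ⟨?_, ?_⟩, ?_⟩
    · simp only [Fin.forall_fin_two, Matrix.cons_val_zero, Matrix.cons_val_one]
      exact ⟨mem_closure_image_iff.2 ⟨α₁, hα₁, rfl⟩, mem_closure_image_iff.2 ⟨α₂, hα₂, rfl⟩⟩
    · simp [sDegree_add]
    · rintro s ⟨hs, hsum⟩
      simp only [Fin.forall_fin_two, Matrix.cons_val_zero, Matrix.cons_val_one] at hs
      obtain ⟨β₁, hβ₁, h1⟩ := mem_closure_image_iff.1 hs.1
      obtain ⟨β₂, hβ₂, h2⟩ := mem_closure_image_iff.1 hs.2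
      rw [Fin.sum_univ_two, ← h1, ← h2, ← sDegree_add] at hsum
      have e := h _ _ hsum
      rw [sDegree_add, sDegree_add, sDegree_indicator_of_subset hβ₁,
        sDegree_indicator_of_subset hα₁, sDegree_indicator_of_disjoint hβ₂,
        sDegree_indicator_of_disjoint hα₂, add_zero, add_zero] at e
      rw [sDegree_add, sDegree_add, e, add_right_inj] at hsum
      funext i
      fin_cases i
      · exact h1.symm.trans e
      · exact h2.symm.trans hsum
  · have hsup : ⨆ i, extendedSubsemigroupIdeal k a (![a '' P, a '' Pᶜ] i) =
        extendedSubsemigroupIdeal k a (a '' P) ⊔ extendedSubsemigroupIdeal k a (a '' Pᶜ) := by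
      refine le_antisymm (iSup_le (Fin.forall_fin_two.2 ⟨le_sup_left, le_sup_right⟩)) (sup_le ?_ ?_)
      · exact le_iSup (fun i => extendedSubsemigroupIdeal k a (![a '' P, a '' Pᶜ] i)) 0
      · exact le_iSup (fun i => extendedSubsemigroupIdeal k a (![a '' P, a '' Pᶜ] i)) 1
    rw [hsup]
    refine le_antisymm (Ideal.span_le.2 ?_) (sup_le ?_ ?_)
    · rintro _ ⟨α, β, hαβ, rfl⟩
      have e := h α β hαβ
      obtain ⟨α₁, α₂, rfl, hα₁, hα₂⟩ := exists_restrict P α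
      obtain ⟨β₁, β₂, rfl, hβ₁, hβ₂⟩ := exists_restrict P β
      rw [sDegree_add, sDegree_add, sDegree_indicator_of_subset hβ₁,
        sDegree_indicator_of_subset hα₁, sDegree_indicator_of_disjoint hβ₂,
        sDegree_indicator_of_disjoint hα₂, add_zero, add_zero] at e
      rw [sDegree_add, sDegree_add, e, add_right_inj] at hαβ
      -- Telescoping through the mixed monomial with exponent `β₁ + α₂`.
      have hdecomp : monomial (α₁ + α₂) (1 : k) - monomial (β₁ + β₂) 1 =
          monomial α₂ 1 * (monomial α₁ 1 - monomial β₁ 1) +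
            monomial β₁ 1 * (monomial α₂ 1 - monomial β₂ 1) := by
        rw [← one_mul (1 : k), ← monomial_mul, ← monomial_mul, one_mul]
        ring
      rw [SetLike.mem_coe, hdecomp]
      refine add_mem (Ideal.mul_mem_left _ _ (Ideal.mem_sup_left ?_))
        (Ideal.mul_mem_left _ _ (Ideal.mem_sup_right ?_))
      · exact sub_mem_extendedSubsemigroupIdeal (fun i hi => ⟨i, hα₁ i hi, rfl⟩)
          (fun i hi => ⟨i, hβ₁ i hi, rfl⟩) e
      · exact sub_mem_extendedSubsemigroupIdeal (fun i hi => ⟨i, hα₂ i hi, rfl⟩)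
          (fun i hi => ⟨i, hβ₂ i hi, rfl⟩) hαβ
    · exact extendedSubsemigroupIdeal_le fun _ _ _ _ => sub_mem_semigroupIdeal
    · exact extendedSubsemigroupIdeal_le fun _ _ _ _ => sub_mem_semigroupIdeal
  · simp only [Fin.forall_fin_two, Matrix.cons_val_zero, Matrix.cons_val_one,
      subsemigroupIdeal_ne_bot_iff]
    rw [hP, hPc]
    exact ⟨h₁, h₂⟩

theorem isDecomposable_iff_exists_splitsAlong {a : σ → G} (ha : ∀ i, a i ≠ 0) :
    IsDecomposable k a ↔
      ∃ P : Set σ, SplitsAlong a P ∧ HasRelationIn a P ∧ HasRelationIn a Pᶜ :=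
  ⟨fun h => h.exists_splitsAlong ha, fun ⟨_, h, h₁, h₂⟩ => h.isDecomposable ha h₁ h₂⟩

end Ideals

/-! ### The equivalence of the three conditions. -/

theorem theorem6p1 {k G : Type*} [Field k] [AddCommGroup G] {n : ℕ} (a : Fin n → G)
    (ha : ∀ i, a i ≠ 0)
    (hS : ∀ x ∈ AddSubmonoid.closure (Set.range a),
      -x ∈ AddSubmonoid.closure (Set.range a) → x = 0) :
    List.TFAE [
      IsDecomposable k a,
      ∃ C₁ C₂ : Set G, C₁ ⊂ Set.range a ∧ C₂ ⊂ Set.range a ∧ Disjoint C₁ C₂ ∧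
        Set.range a = C₁ ∪ C₂ ∧
        (∀ m ∈ AddSubmonoid.closure (Set.range a), ¬ IsConnectedComplex (nablaComplex a m) →
          NablaVerticesIn k a m C₁ ∨ NablaVerticesIn k a m C₂) ∧
        ∃ m₁ ∈ AddSubmonoid.closure (Set.range a), ∃ m₂ ∈ AddSubmonoid.closure (Set.range a),
          ¬ IsConnectedComplex (nablaComplex a m₁) ∧ ¬ IsConnectedComplex (nablaComplex a m₂) ∧
          NablaVerticesIn k a m₁ C₁ ∧ NablaVerticesIn k a m₂ C₂,
      ∃ C₁ C₂ : Set (Fin n), C₁ ⊂ Set.univ ∧ C₂ ⊂ Set.univ ∧ Disjoint C₁ C₂ ∧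
        Set.univ = C₁ ∪ C₂ ∧
        (∀ m ∈ AddSubmonoid.closure (Set.range a), ¬ IsConnectedComplex (deltaComplex a m) →
          complexVertices (deltaComplex a m) ⊆ C₁ ∨ complexVertices (deltaComplex a m) ⊆ C₂) ∧
        ∃ m₁ ∈ AddSubmonoid.closure (Set.range a), ∃ m₂ ∈ AddSubmonoid.closure (Set.range a),
          ¬ IsConnectedComplex (deltaComplex a m₁) ∧ ¬ IsConnectedComplex (deltaComplex a m₂) ∧
          complexVertices (deltaComplex a m₁) ⊆ C₁ ∧ complexVertices (deltaComplex a m₂) ⊆ C₂] := by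
  have hpos : ∀ α : Fin n →₀ ℕ, sDegree a α = 0 → α = 0 :=
    fun α => eq_zero_of_sDegree_eq_zero ha hS
  tfae_have 1 → 3 := by
    intro h
    obtain ⟨P, hP⟩ := (isDecomposable_iff_exists_splitsAlong ha).1 h
    obtain ⟨hsep, hex⟩ := (splitsAlong_iff_separatesDisconnected hpos).1 hP
    refine ⟨P, Pᶜ, ?_, ?_, disjoint_compl_right, (Set.union_compl_self P).symm, ?_⟩
    · exact Set.ssubset_univ_iff.2 (Set.nonempty_compl.1 hP.2.2.nonempty)
    · exact Set.ssubset_univ_iff.2 (Set.nonempty_compl.1 (by simpa using hP.2.1.nonempty))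
    · simp only [vertices_deltaComplex_subset_iff, ← isConnectedComplex_nabla_iff_delta]
      exact ⟨hsep, hex⟩
  tfae_have 3 → 2 := by
    rintro ⟨P, Q, -, -, hd, hu, h⟩
    obtain rfl : Pᶜ = Q := by rw [Set.compl_eq_univ_sdiff, sdiff_eq_of_disjoint_of_eq_union hd hu]
    simp only [vertices_deltaComplex_subset_iff, ← isConnectedComplex_nabla_iff_delta] at h
    -- Splitting is recovered first because it makes the images of `P` and `Pᶜ` disjoint even when
    -- `a` is not injective.
    obtain ⟨hP, h₁, h₂⟩ := (splitsAlong_iff_separatesDisconnected hpos).2 h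
    have hdisj : Disjoint (a '' P) (a '' Pᶜ) := by
      rw [Set.disjoint_left]
      rintro _ ⟨i, hi, rfl⟩ ⟨j, hj, hij⟩
      exact hj (hP.mem_of_eq ha hij.symm hi)
    have hunion : Set.range a = a '' P ∪ a '' Pᶜ := by
      rw [← Set.image_union, Set.union_compl_self, Set.image_univ]
    refine ⟨a '' P, a '' Pᶜ, ?_, ?_, hdisj, hunion, ?_⟩
    · refine ⟨Set.image_subset_range a P, fun hle => ?_⟩
      obtain ⟨i, hi⟩ := h₂.nonempty
      exact Set.disjoint_left.1 hdisj (hle ⟨i, rfl⟩) ⟨i, hi, rfl⟩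
    · refine ⟨Set.image_subset_range a Pᶜ, fun hle => ?_⟩
      obtain ⟨i, hi⟩ := h₁.nonempty
      exact Set.disjoint_left.1 hdisj ⟨i, hi, rfl⟩ (hle ⟨i, rfl⟩)
    · simp only [nablaVerticesIn_iff, hP.preimage_image ha, hP.compl.preimage_image ha]
      exact h
  tfae_have 2 → 1 := by
    rintro ⟨C₁, C₂, -, -, hd, hu, h⟩
    have hpre : a ⁻¹' C₂ = (a ⁻¹' C₁)ᶜ := by
      rw [← sdiff_eq_of_disjoint_of_eq_union hd hu, Set.preimage_sdiff, Set.preimage_range, Set.compl_eq_univ_sdiff]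
    simp only [nablaVerticesIn_iff, hpre] at h
    exact (isDecomposable_iff_exists_splitsAlong ha).2
      ⟨_, (splitsAlong_iff_separatesDisconnected hpos).2 h⟩
  tfae_finish
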